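/- Let $\Bbbk$ be an algebraically closed field of characteristic zero, $G$ a group, and $R$ an associative unital $\Bbbk$-algebra. A (left) \emph{partial action} of a Hopf algebra $\mathcal H$ on $R$ is a linear map $\cdot:\mathcal H\otimes R\to R$ such that, for all $h,l\in\mathcal H$ and $r,s\in R$ (Sweedler notation $\Delta(h)=h_1\otimes h_2$), $$1_{\mathcal H}\cdot r=r,\qquad h\cdot(rs)=(h_1\cdot r)(h_2\cdot s),\qquad h\cdot(l\cdot r)=(h_1\cdot 1_R)(h_2l\cdot r);$$ it is \emph{symmetric} if moreover $h\cdot(l\cdot r)=(h_1l\cdot r)(h_2\cdot 1_R)$. Let $\sigma$ be an algebra automorphism of the group algebra $\Bbbk G$, and let $\Bbbk G[x,\sigma]$ be a Hopf-Ore extension of $\Bbbk G$: it is the Ore extension, i.e. the algebra generated by $\Bbbk G$ and $x$ with $xa=\sigma(a)x$ for $a\in\Bbbk G$, in which every element is uniquely $\sum_i a_ix^i$ with $a_i\in\Bbbk G$, equipped with a Hopf algebra structure that extends that of $\Bbbk G$ and satisfies $\Delta(x)=x\otimes 1+g\otimes x$ for a grouplike element $g\in\Bbbk G$. Let $\chi:\Bbbk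 G\to\Bbbk$ be the character with $\sigma(a)=\chi(a_1)a_2$, i.e. $\chi=\varepsilon\circ\sigma$. For $n,m\ge 0$ and $p\in\Bbbk^\times$, let $\binom{n}{m}_p$ be the $q$-binomial coefficients: $\binom00_p=1$, $\binom nm_p=0$ if $m>n$ or $m<0$, and $\binom nm_p=\binom{n-1}m_p+p^{\,n-m}\binom{n-1}{m-1}_p$ for $n\ge 1$, $0\le m\le n$. \textbf{Theorem.} Let $\cdot:\Bbbk G[x,\sigma]\otimes R\to R$ be a linear map with $g\cdot 1_R=0$. Then $\cdot$ is a partial action of $\Bbbk G[x,\sigma]$ on $R$ if and only if the following three conditions hold: (1) the restriction $\cdot|_{\Bbbk G\otimes R}$ is a partial action of $\Bbbk G$ on $R$; (2) $a\cdot(x\cdot 1_R)=(\sigma^{-1}(a)\cdot 1_R)(x\cdot 1_R)$ for all $a\in\Bbbk G$; (3) with $q=\chi(g)$ and $w=x\cdot 1_R$, for all $j\ge 0$, $a\in\Bbbk G$ and $r\in R$, $$x^ja\cdot r=\sum_{k=0}^{j}(-1)^kq^{-\frac{k(k-1)}2}\binom jk_{q^{-1}}w^{j-k}\,(g^ka\cdot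 r)\,w^k .$$ Likewise, $\cdot$ is a symmetric partial action of $\Bbbk G[x,\sigma]$ on $R$ if and only if $\cdot|_{\Bbbk G\otimes R}$ is a symmetric partial action of $\Bbbk G$ on $R$ and (2) and (3) hold. -/

import Mathlib

open scoped TensorProduct

section OreExtension

variable {k A H : Type*} [Field k] [Ring A] [Ring H]

/-- `H`, together with the algebra map `ι : A → H` and the element `x`, is the Ore extension
`A[x, σ] = A[x, σ, 0]`: the relation `x a = σ(a) x` holds, and every element of `H` is
`∑ aᵢ xⁱ` for a unique finitely supported family of coefficients `aᵢ ∈ A`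
(so `ι` is injective, and `H` is determined by `A` and `σ` up to a unique isomorphism). -/
structure IsOreExtension [Algebra k A] [Algebra k H]
    (σ : A ≃ₐ[k] A) (ι : A →ₐ[k] H) (x : H) : Prop where
  x_mul : ∀ a : A, x * ι a = ι (σ a) * x
  existsUnique_repr : ∀ h : H, ∃! p : ℕ →₀ A, h = p.sum fun i a => ι a * x ^ i

/-- `H` is a Hopf-Ore extension `A[x, σ]` of the Hopf algebra `A`: it is an Ore extension, its
Hopf algebra structure extends that of `A` (`ι` is a map of bialgebras), and
`Δ(x) = x ⊗ 1 + g ⊗ x` with `g` a grouplike element of `A`. -/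
structure IsHopfOreExtension [HopfAlgebra k A] [HopfAlgebra k H]
    (σ : A ≃ₐ[k] A) (ι : A →ₐc[k] H) (x : H) (g : A) : Prop where
  isOreExtension : IsOreExtension σ (ι : A →ₐ[k] H) x
  isGroupLikeElem : IsGroupLikeElem k g
  comul_x : Coalgebra.comul (R := k) x = x ⊗ₜ[k] (1 : H) + ι g ⊗ₜ[k] x

/-- The character `χ : A → k` attached to a Hopf-Ore extension `A[x, σ]`, that is, the character
with `σ(a) = χ(a₁) a₂`. Applying the counit `ε` to this formula shows that `χ = ε ∘ σ`
(see `eq_oreCharacter`), which is taken as the definition. -/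
noncomputable def oreCharacter [HopfAlgebra k A] (σ : A ≃ₐ[k] A) : A →ₐ[k] k :=
  (Bialgebra.counitAlgHom k A).comp (σ : A →ₐ[k] A)

/-- Any character `χ` with `σ(a) = χ(a₁) a₂` is `oreCharacter σ`. -/
theorem eq_oreCharacter [HopfAlgebra k A] (σ : A ≃ₐ[k] A) (χ : A →ₐ[k] k)
    (hχ : ∀ a : A, σ a =
      TensorProduct.lid k A (TensorProduct.map χ.toLinearMap LinearMap.id
        (Coalgebra.comul (R := k) a))) :
    χ = oreCharacter σ := by
  ext a
  have key : ∀ t : A ⊗[k] A, Coalgebra.counit (R := k)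
      (TensorProduct.lid k A (TensorProduct.map χ.toLinearMap LinearMap.id t)) =
      χ (TensorProduct.rid k A (LinearMap.lTensor A (Coalgebra.counit (R := k)) t)) := by
    intro t
    induction t using TensorProduct.induction_on with
    | zero => simp
    | tmul a b => simp [mul_comm]
    | add s t hs ht => simp only [map_add, hs, ht]
  have h := key (Coalgebra.comul (R := k) a)
  rw [← hχ, Coalgebra.lTensor_counit_comul] at h
  simpa [oreCharacter] using h.symm

end OreExtension

section PartialAction

variable {k H R : Type*} [Field k] [Ring H] [HopfAlgebra k H] [Ring R] [Algebra k R]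

/-- For linear maps `u v : H → R`, the linear map `h ↦ u(h₁) v(h₂)` in Sweedler notation. -/
noncomputable def sweedler (u v : H →ₗ[k] R) : H →ₗ[k] R :=
  LinearMap.mul' k R ∘ₗ TensorProduct.map u v ∘ₗ Coalgebra.comul

/-- A left partial action of the Hopf algebra `H` on the algebra `R`. A linear map
`H ⊗ R → R` is given in curried form, so that `act h r` is `h · r`. -/
structure IsPartialAction (act : H →ₗ[k] R →ₗ[k] R) : Prop where
  /-- `1 · r = r` -/
  one_act : ∀ r : R, act 1 r = r
  /-- `h · (r s) = (h₁ · r) (h₂ · s)` -/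
  act_mul : ∀ (h : H) (r s : R), act h (r * s) = sweedler (act.flip r) (act.flip s) h
  /-- `h · (l · r) = (h₁ · 1) (h₂ l · r)` -/
  act_act : ∀ (h l : H) (r : R), act h (act l r) =
    sweedler (act.flip 1) (act.flip r ∘ₗ LinearMap.mulRight k l) h

/-- A symmetric left partial action of `H` on `R`. -/
structure IsSymmetricPartialAction (act : H →ₗ[k] R →ₗ[k] R) : Prop
    extends IsPartialAction act where
  /-- `h · (l · r) = (h₁ l · r) (h₂ · 1)` -/
  act_act_symm : ∀ (h l : H) (r : R), act h (act l r) =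
    sweedler (act.flip r ∘ₗ LinearMap.mulRight k l) (act.flip 1) h

end PartialAction

/-- The `q`-binomial coefficients: `(0 choose 0)_q = 1`, `(n choose m)_q = 0` for `m > n`, and
`(n choose m)_q = (n-1 choose m)_q + q^(n-m) (n-1 choose m-1)_q` for `n ≥ 1`, where
`(n-1 choose -1)_q = 0`. (When the exponent below is truncated, its coefficient is `0`.) -/
def qBinom {k : Type*} [Field k] (q : k) : ℕ → ℕ → k
  | _, 0 => 1
  | 0, _ + 1 => 0
  | n + 1, m + 1 => qBinom q n (m + 1) + q ^ (n - m) * qBinom q n m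

/-- The map `act : A[x, σ] ⊗ R → R` is given on the elements `xʲ a` by the extension formula
`xʲ a · r = ∑_{i=0}^{j} (-1)ⁱ q^{-i(i-1)/2} (j choose i)_{q⁻¹} w^{j-i} (gⁱ a · r) wⁱ`. -/
def IsGivenByExtensionFormula {k A H R : Type*} [Field k] [Ring A] [Algebra k A]
    [Ring H] [Algebra k H] [Ring R] [Algebra k R]
    (ι : A →ₐ[k] H) (x : H) (g : A) (act : H →ₗ[k] R →ₗ[k] R) (q : k) (w : R) : Prop :=
  ∀ (j : ℕ) (a : A) (r : R), act (x ^ j * ι a) r =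
    ∑ i ∈ Finset.range (j + 1),
      ((-1) ^ i * q⁻¹ ^ (i * (i - 1) / 2) * qBinom q⁻¹ j i) •
        (w ^ (j - i) * act (ι (g ^ i * a)) r * w ^ i)

/-!
The key notion is that of a *twisted* map: writing `w = x · 1`, a linear map `f : H → R` is twisted
if `f(x l) = w f(l) - f(g l) w` for all `l ∈ H`. The extension formula says precisely that
`h ↦ h · r` is twisted for every `r`: iterating the recursion, with `g x = q⁻¹ x g`, gives a sum
whose coefficients obey the Pascal rule of the `q`-binomials (`IsTwisted.pow_mul`,
`IsSkewExtension.isTwisted_of_pow_mul`).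

Comparing coefficients in `Δ(x) Δ(u) = Δ(σ(u)) Δ(x)` for `u ∈ G` shows that `σ(u) = χ(u) u` and
that `g` is a central element of `G` (`IsHopfOreExtension.apply_of`); this is all that is needed of
the Ore extension, besides its being spanned by the products `xʲ u`.

If `·` is a partial action with `g · 1 = 0`, then also `g⁻¹ · 1 = 0`, and expanding
`(g⁻¹ x) · (g l · r)` gives the twisted recursion
(`IsSkewExtension.isTwisted_of_isPartialAction`). The condition on `a · (x · 1)` follows by
evaluating `u · (x u⁻¹ · 1)` in two ways (`IsSkewExtension.act_map_act_x`).

Conversely, twisted maps are closed under `h ↦ f(h₁) f'(h₂)` (`IsTwisted.sweedler`), and two twisted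
maps that agree on `G` are equal (`IsSkewExtension.isTwisted_ext`). Both sides of each axiom of a
(symmetric) partial action are twisted as functions of the acting element `h`, so it suffices to
take `h = u ∈ G`. Then `u · (r s) = (u · r) (u · s)` holds by assumption, and the formulas for
`u · (l · r)` follow by induction on `l`, from `e w e = e w` with `e = u · 1`, and in the symmetric
case from the centrality of `e`.
-/

open Coalgebra

/-! ### The coefficients of the extension formula -/

section Coefficients

variable {k R : Type*} [Field k] [Ring R] [Algebra k R]

/-- The coefficient of `w ^ (j - i) * (gⁱ a · r) * w ^ i` in the extension formula, with
`p = q⁻¹`. -/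
def extensionCoeff (p : k) (j i : ℕ) : k :=
  (-1) ^ i * p ^ (i * (i - 1) / 2) * qBinom p j i

lemma qBinom_eq_zero_of_lt (p : k) : ∀ {n m : ℕ}, n < m → qBinom p n m = 0
  | 0, m + 1, _ => by simp [qBinom]
  | n + 1, m + 1, h => by
    rw [qBinom, qBinom_eq_zero_of_lt p (by omega : n < m + 1),
      qBinom_eq_zero_of_lt p (by omega : n < m)]
    simp

@[simp] lemma extensionCoeff_zero_right (p : k) (j : ℕ) : extensionCoeff p j 0 = 1 := by
  cases j <;> simp [extensionCoeff, qBinom]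

lemma extensionCoeff_self_succ (p : k) (j : ℕ) : extensionCoeff p j (j + 1) = 0 := by
  simp [extensionCoeff, qBinom_eq_zero_of_lt p (Nat.lt_succ_self j)]

lemma extensionCoeff_succ_succ (p : k) {j i : ℕ} (h : i ≤ j) :
    extensionCoeff p (j + 1) (i + 1) =
      extensionCoeff p j (i + 1) - p ^ j * extensionCoeff p j i := by
  have e : (i + 1) * (i + 1 - 1) / 2 = i * (i - 1) / 2 + i := by
    rw [← Nat.add_mul_div_right _ _ (by norm_num : 0 < 2)]
    congr 1
    cases i with
    | zero => rfl
    | succ n => simp only [Nat.add_sub_cancel]; ring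
  obtain ⟨d, rfl⟩ := Nat.exists_eq_add_of_le h
  simp only [extensionCoeff, qBinom, e, Nat.add_sub_cancel_left]
  ring

/-- The right-hand side of the extension formula, for the family `c i = gⁱ a · r`. -/
def extensionSum (p : k) (w : R) (j : ℕ) (c : ℕ → R) : R :=
  ∑ i ∈ Finset.range (j + 1), extensionCoeff p j i • (w ^ (j - i) * c i * w ^ i)

@[simp] lemma extensionSum_zero (p : k) (w : R) (c : ℕ → R) : extensionSum p w 0 c = c 0 := by
  simp [extensionSum]

/-- The Pascal rule for the extension formula, matching the recursion of `IsTwisted`. -/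
lemma extensionSum_succ (p : k) (w : R) (j : ℕ) (c : ℕ → R) :
    extensionSum p w (j + 1) c =
      w * extensionSum p w j c - p ^ j • (extensionSum p w j (fun i => c (i + 1)) * w) := by
  have h1 : w * extensionSum p w j c = w ^ (j + 1) * c 0 +
      ∑ i ∈ Finset.range (j + 1),
        extensionCoeff p j (i + 1) • (w ^ (j - i) * c (i + 1) * w ^ (i + 1)) := by
    rw [extensionSum, Finset.sum_range_succ', mul_add, Finset.sum_range_succ,
      extensionCoeff_self_succ, zero_smul, add_zero, add_comm, Finset.mul_sum]
    congr 1
    · simp [pow_succ', mul_assoc]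
    · refine Finset.sum_congr rfl fun i hi => ?_
      have : j - i = (j - (i + 1)) + 1 := by have := Finset.mem_range.1 hi; omega
      rw [mul_smul_comm, this, pow_succ' w (j - (i + 1))]
      simp only [mul_assoc]
  rw [h1, extensionSum, Finset.sum_range_succ', extensionSum, Finset.sum_mul, Finset.smul_sum,
    add_comm, add_sub_assoc, ← Finset.sum_sub_distrib]
  congr 1
  · simp
  · refine Finset.sum_congr rfl fun i hi => ?_
    rw [extensionCoeff_succ_succ p (Nat.lt_succ_iff.1 (Finset.mem_range.1 hi)), sub_smul, mul_smul,
      smul_mul_assoc, Nat.add_sub_add_right, pow_succ w i]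
    simp only [mul_assoc]

end Coefficients

/-! ### Twisted maps -/

section Twisted

variable {k H R : Type*} [Field k] [Ring H] [Ring R] [Algebra k R]

/-- A linear map `f : H → R` is twisted if `f(x l) = w f(l) - f(g l) w` for all `l`. -/
def IsTwisted [Algebra k H] (x g : H) (w : R) (f : H →ₗ[k] R) : Prop :=
  ∀ l : H, f (x * l) = w * f l - f (g * l) * w

lemma IsTwisted.comp_mulRight [Algebra k H] {x g : H} {w : R} {f : H →ₗ[k] R}
    (hf : IsTwisted x g w f) (l : H) : IsTwisted x g w (f ∘ₗ LinearMap.mulRight k l) := by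
  intro m
  simpa [mul_assoc] using hf (m * l)

/-- Twisted maps satisfy the extension formula, if `g x = p x g`. -/
lemma IsTwisted.pow_mul [Algebra k H] {x g : H} {w : R} {f : H →ₗ[k] R}
    (hf : IsTwisted x g w f) {p : k} (hgx : g * x = p • (x * g)) (j : ℕ) (b : H) :
    f (x ^ j * b) = extensionSum p w j (fun i => f (g ^ i * b)) := by
  have hgx' : ∀ j : ℕ, g * x ^ j = p ^ j • (x ^ j * g) := by
    intro j
    induction j with
    | zero => simp
    | succ j ih =>
      rw [pow_succ x, ← mul_assoc, ih, smul_mul_assoc, mul_assoc, hgx, mul_smul_comm, smul_smul,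
        pow_succ p, mul_assoc]
  induction j generalizing b with
  | zero => simp
  | succ j ih =>
    rw [pow_succ', mul_assoc, hf, extensionSum_succ, ← mul_assoc g, hgx', smul_mul_assoc, map_smul,
      mul_assoc, ih, ih, smul_mul_assoc]
    simp only [← mul_assoc, ← pow_succ]

variable [HopfAlgebra k H]

lemma sweedler_mul_of_comul_eq_tmul (u v : H →ₗ[k] R) {a : H}
    (ha : comul (R := k) a = a ⊗ₜ[k] a) (h : H) :
    sweedler u v (a * h) =
      sweedler (u ∘ₗ LinearMap.mulLeft k a) (v ∘ₗ LinearMap.mulLeft k a) h := by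
  simp only [sweedler, LinearMap.comp_apply, Bialgebra.comul_mul, ha]
  generalize comul (R := k) h = t
  induction t using TensorProduct.induction_on with
  | zero => simp
  | tmul b c => simp
  | add s t hs ht => simp only [mul_add, map_add, hs, ht]

lemma sweedler_of_comul_eq_tmul (u v : H →ₗ[k] R) {a : H}
    (ha : comul (R := k) a = a ⊗ₜ[k] a) : sweedler u v a = u a * v a := by
  simp [sweedler, ha]

lemma sweedler_of_comul_eq_tmul_add_tmul (u v : H →ₗ[k] R) {y a b c d : H}
    (hy : comul (R := k) y = a ⊗ₜ[k] b + c ⊗ₜ[k] d) :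
    sweedler u v y = u a * v b + u c * v d := by
  simp [sweedler, hy]

/-- Twisted maps are closed under `h ↦ u(h₁) v(h₂)`: in `Δ(x h) = x h₁ ⊗ h₂ + g h₁ ⊗ x h₂` the
terms `u(g h₁) w v(h₂)` cancel. -/
lemma IsTwisted.sweedler {x g : H} {w : R} {u v : H →ₗ[k] R}
    (hg : comul (R := k) g = g ⊗ₜ[k] g)
    (hx : comul (R := k) x = x ⊗ₜ[k] (1 : H) + g ⊗ₜ[k] x)
    (hu : IsTwisted x g w u) (hv : IsTwisted x g w v) : IsTwisted x g w (sweedler u v) := by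
  intro h
  rw [sweedler_mul_of_comul_eq_tmul u v hg]
  simp only [_root_.sweedler, LinearMap.comp_apply, Bialgebra.comul_mul, hx]
  generalize comul (R := k) h = t
  induction t using TensorProduct.induction_on with
  | zero => simp
  | tmul b c =>
    simp only [add_mul, Algebra.TensorProduct.tmul_mul_tmul, map_add, TensorProduct.map_tmul,
      LinearMap.mul'_apply, LinearMap.comp_apply, LinearMap.mulLeft_apply, hu b, hv c, one_mul]
    noncomm_ring
  | add s t hs ht =>
    simp only [mul_add, map_add, hs, ht]
    rw [add_mul]
    abel

end Twisted

/-! ### Partial actions of skew extensions -/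

section SkewExtension

variable {k G H R : Type*} [Field k] [Group G] [Ring H] [HopfAlgebra k H] [Ring R] [Algebra k R]

/-- The part of the structure of a Hopf-Ore extension `H` of `kG` that the argument uses: `H` is
spanned by the products `xʲ u` with `u ∈ G` grouplike, `x u = χ(u) u x` for a character `χ` of
`G`, and `Δ(x) = x ⊗ 1 + γ ⊗ x` with `γ` central in `G`. -/
structure IsSkewExtension (U : G →* H) (χ : G →* k) (γ : G) (x : H) : Prop where
  comul_apply : ∀ u, comul (R := k) (U u) = U u ⊗ₜ[k] U u
  comul_x : comul (R := k) x = x ⊗ₜ[k] (1 : H) + U γ ⊗ₜ[k] x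
  x_mul : ∀ u, x * U u = χ u • (U u * x)
  central : ∀ u, γ * u = u * γ
  eq_top : ∀ M : Submodule k H, (∀ j u, x ^ j * U u ∈ M) → M = ⊤

namespace IsSkewExtension

variable {U : G →* H} {χ : G →* k} {γ : G} {x : H}

lemma char_ne_zero (χ : G →* k) (u : G) : χ u ≠ 0 := fun h => by
  simpa [h] using (map_mul χ u u⁻¹).symm

lemma map_mul_x (hD : IsSkewExtension U χ γ x) (u : G) : U u * x = (χ u)⁻¹ • (x * U u) := by
  rw [hD.x_mul, smul_smul, inv_mul_cancel₀ (char_ne_zero χ u), one_smul]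

lemma map_mul_pow (hD : IsSkewExtension U χ γ x) (u : G) (j : ℕ) :
    U u * x ^ j = (χ u)⁻¹ ^ j • (x ^ j * U u) := by
  induction j with
  | zero => simp
  | succ j ih =>
    rw [pow_succ x, ← mul_assoc, ih, smul_mul_assoc, mul_assoc, hD.map_mul_x, mul_smul_comm,
      smul_smul, pow_succ (χ u)⁻¹, mul_assoc]

/-- Induction principle: a subspace containing `G` and closed under `l, γ l ↦ x l` is
everything. -/
lemma mem_of_step (hD : IsSkewExtension U χ γ x) (M : Submodule k H) (h0 : ∀ u, U u ∈ M)
    (hx : ∀ l, l ∈ M → U γ * l ∈ M → x * l ∈ M) (l : H) : l ∈ M := by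
  rw [hD.eq_top M fun j => ?_]
  · trivial
  induction j with
  | zero => simpa using h0
  | succ j ih =>
    intro u
    rw [pow_succ', mul_assoc]
    refine hx _ (ih u) ?_
    rw [← mul_assoc, hD.map_mul_pow, smul_mul_assoc, mul_assoc, ← map_mul]
    exact M.smul_mem _ (ih _)

lemma isTwisted_ext (hD : IsSkewExtension U χ γ x) {w : R} {f f' : H →ₗ[k] R}
    (hf : IsTwisted x (U γ) w f) (hf' : IsTwisted x (U γ) w f') (h : ∀ u, f (U u) = f' (U u)) :
    f = f' := by
  ext l
  refine hD.mem_of_step (LinearMap.eqLocus f f') h (fun l hl hl' => ?_) l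
  rw [LinearMap.mem_eqLocus] at *
  rw [hf, hf', hl, hl']

/-- A map given by the extension formula is twisted: this is the converse of
`IsTwisted.pow_mul`. -/
lemma isTwisted_of_pow_mul (hD : IsSkewExtension U χ γ x) {w : R} {f : H →ₗ[k] R}
    (h : ∀ j u, f (x ^ j * U u) =
      extensionSum (χ γ)⁻¹ w j (fun i => f (U γ ^ i * U u))) : IsTwisted x (U γ) w f := by
  have key : ∀ j u, f (x * (x ^ j * U u)) =
      w * f (x ^ j * U u) - f (U γ * (x ^ j * U u)) * w := by
    intro j u
    have h1 := h (j + 1) u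
    have h2 : f (x ^ j * (U γ * U u)) =
        extensionSum (χ γ)⁻¹ w j (fun i => f (U γ ^ (i + 1) * U u)) := by
      simpa [pow_succ, mul_assoc] using h j (γ * u)
    rw [extensionSum_succ, ← h, ← h2, pow_succ', mul_assoc] at h1
    rw [h1, ← mul_assoc (U γ), hD.map_mul_pow, smul_mul_assoc, map_smul, mul_assoc,
      smul_mul_assoc]
  have htop := hD.eq_top (LinearMap.eqLocus (f ∘ₗ LinearMap.mulLeft k x)
    (LinearMap.mulLeft k w ∘ₗ f - LinearMap.mulRight k w ∘ₗ f ∘ₗ LinearMap.mulLeft k (U γ))) key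
  intro l
  exact (htop ▸ Submodule.mem_top : l ∈ LinearMap.eqLocus _ _)

section Restriction

variable {act : H →ₗ[k] R →ₗ[k] R}

lemma act_map_mul (hD : IsSkewExtension U χ γ x) (h : IsPartialAction act) (u : G) (r s : R) :
    act (U u) (r * s) = act (U u) r * act (U u) s := by
  rw [h.act_mul, sweedler_of_comul_eq_tmul _ _ (hD.comul_apply u)]; rfl

lemma act_map_act (hD : IsSkewExtension U χ γ x) (h : IsPartialAction act) (u : G) (l : H)
    (r : R) : act (U u) (act l r) = act (U u) 1 * act (U u * l) r := by
  rw [h.act_act, sweedler_of_comul_eq_tmul _ _ (hD.comul_apply u)]; rfl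

/-- A partial action with `γ · 1 = 0` satisfies `x l · r = w (l · r) - (γ l · r) w` with
`w = x · 1`. This comes from the element `y = γ⁻¹ x` with `Δ(y) = y ⊗ γ⁻¹ + 1 ⊗ y`: as
`γ⁻¹ · 1 = 0`, it acts on `R` by `s ↦ s (y · 1)`, and `y · (γ l · r)` is
`(y · 1) (l · r) + (y γ l · r)`. -/
lemma isTwisted_of_isPartialAction (hD : IsSkewExtension U χ γ x) (h : IsPartialAction act)
    (hγ : act (U γ) 1 = 0) (r : R) : IsTwisted x (U γ) (act x 1) (act.flip r) := by
  set q := χ γ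
  have hq0 : q ≠ 0 := char_ne_zero χ γ
  have hγ' : act (U γ⁻¹) 1 = 0 := by
    have := hD.act_map_act h γ⁻¹ (U γ) 1
    rw [hγ, ← U.map_mul, inv_mul_cancel, U.map_one, h.one_act] at this
    simpa using this.symm
  have hUU : U γ⁻¹ * U γ = 1 := by rw [← map_mul, inv_mul_cancel, map_one]
  have hy : comul (R := k) (U γ⁻¹ * x) =
      (U γ⁻¹ * x) ⊗ₜ[k] U γ⁻¹ + (1 : H) ⊗ₜ[k] (U γ⁻¹ * x) := by
    rw [Bialgebra.comul_mul, hD.comul_apply, hD.comul_x, mul_add]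
    simp [hUU]
  have hyγ : ∀ l, U γ⁻¹ * x * (U γ * l) = q • (x * l) := by
    intro l
    rw [← mul_assoc, mul_assoc (U γ⁻¹), hD.x_mul, mul_smul_comm, ← mul_assoc, hUU, one_mul,
      smul_mul_assoc]
  have hyact : ∀ l s, act (U γ⁻¹ * x) (act (U γ * l) s) =
      act (U γ⁻¹ * x) 1 * act l s + q • act (x * l) s := by
    intro l s
    rw [h.act_act, sweedler_of_comul_eq_tmul_add_tmul _ _ hy]
    simp only [LinearMap.comp_apply, LinearMap.mulRight_apply, LinearMap.flip_apply, hyγ,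
      h.one_act, one_mul, map_smul]
    rw [← mul_assoc, hUU, one_mul]
  have hy1 : act (U γ⁻¹ * x) 1 = -(q • act x 1) := by
    have := hyact 1 1
    rw [mul_one, mul_one, hγ, map_zero, h.one_act, mul_one] at this
    exact eq_neg_of_add_eq_zero_left this.symm
  have hys : ∀ s, act (U γ⁻¹ * x) s = s * act (U γ⁻¹ * x) 1 := by
    intro s
    have := h.act_mul (U γ⁻¹ * x) s 1
    rw [sweedler_of_comul_eq_tmul_add_tmul _ _ hy, mul_one] at this
    simpa [hγ', h.one_act] using this
  intro l
  have := hyact l r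
  rw [hys, hy1] at this
  simp only [LinearMap.flip_apply]
  have h3 : q • act (x * l) r = q • (act x 1 * act l r - act (U γ * l) r * act x 1) := by
    rw [mul_neg, neg_mul, mul_smul_comm, smul_mul_assoc] at this
    rw [smul_sub, sub_eq_add_neg, this, add_neg_cancel_left]
  exact smul_right_injective R hq0 h3

/-- The formula for `u · w` with `w = x · 1`. It follows from evaluating `u · (x u⁻¹ · 1)` in two
ways: as `u · w` by the twisted recursion, and as `(u · 1) (u x u⁻¹ · 1)`. -/
lemma act_map_act_x (hD : IsSkewExtension U χ γ x) (h : IsPartialAction act)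
    (hγ : act (U γ) 1 = 0) (u : G) :
    act (U u) (act x 1) = (χ u)⁻¹ • (act (U u) 1 * act x 1) := by
  have h1 := hD.isTwisted_of_isPartialAction h hγ 1 (U u⁻¹)
  simp only [LinearMap.flip_apply] at h1
  have h2 := hD.act_map_act h u (x * U u⁻¹) 1
  have h3 : act (U u) (act (U u⁻¹) 1) = act (U u) 1 := by
    rw [hD.act_map_act h, ← U.map_mul, mul_inv_cancel, U.map_one, h.one_act, mul_one]
  have h4 : act (U u) (act (U γ * U u⁻¹) 1) = 0 := by
    rw [hD.act_map_act h, ← U.map_mul, ← U.map_mul, ← mul_assoc u, ← hD.central,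
      mul_inv_cancel_right, hγ, mul_zero]
  have h5 : U u * (x * U u⁻¹) = (χ u)⁻¹ • x := by
    rw [← mul_assoc, hD.map_mul_x, smul_mul_assoc, mul_assoc, ← U.map_mul, mul_inv_cancel,
      U.map_one, mul_one]
  rw [h1, map_sub, hD.act_map_mul h, hD.act_map_mul h, h3, h4, zero_mul, sub_zero,
    ← hD.act_map_mul h, mul_one, h5, map_smul, LinearMap.smul_apply, mul_smul_comm] at h2
  exact h2

variable (hD : IsSkewExtension U χ γ x)
  (one_act : ∀ r, act 1 r = r)
  (map_mul' : ∀ u r s, act (U u) (r * s) = act (U u) r * act (U u) s)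
  (map_act : ∀ u v r, act (U u) (act (U v) r) = act (U u) 1 * act (U (u * v)) r)
  (map_act_symm : ∀ u v r, act (U u) (act (U v) r) = act (U (u * v)) r * act (U u) 1)
  (map_act_x : ∀ u, act (U u) (act x 1) = (χ u)⁻¹ • (act (U u) 1 * act x 1))
  (tw : ∀ r, IsTwisted x (U γ) (act x 1) (act.flip r))

include map_mul' map_act_x tw in
/-- The recursion in `l` satisfied by `u · (l · r)`. The factor `u · 1` of `u · w` is absorbed on
its left by `u · (g l · r)`. -/
lemma act_map_act_x_mul (u : G) (l : H) (r : R) :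
    act (U u) (act (x * l) r) = (χ u)⁻¹ • (act (U u) 1 * act x 1 * act (U u) (act l r) -
      act (U u) (act (U γ * l) r) * act x 1) := by
  have h1 := tw r l
  simp only [LinearMap.flip_apply] at h1
  rw [h1, map_sub, map_mul', map_mul', map_act_x, smul_mul_assoc, mul_smul_comm, ← smul_sub,
    ← mul_assoc (act (U u) (act (U γ * l) r)), ← map_mul', mul_one]

include hD tw in
/-- The recursion in `l` satisfied by `u l · r`. It uses that `γ` is central. -/
lemma act_map_mul_x_mul (u : G) (l : H) (r : R) :
    act (U u * (x * l)) r = (χ u)⁻¹ • (act x 1 * act (U u * l) r -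
      act (U u * (U γ * l)) r * act x 1) := by
  have h1 := tw r (U u * l)
  simp only [LinearMap.flip_apply] at h1
  rw [← mul_assoc, hD.map_mul_x, smul_mul_assoc, mul_assoc, map_smul, LinearMap.smul_apply, h1,
    ← mul_assoc (U γ), ← U.map_mul, hD.central, U.map_mul, mul_assoc (U u)]

include hD map_mul' map_act map_act_x tw in
lemma act_map_act_of_isTwisted (u : G) (l : H) (r : R) :
    act (U u) (act l r) = act (U u) 1 * act (U u * l) r := by
  refine hD.mem_of_step (LinearMap.eqLocus (act (U u) ∘ₗ act.flip r)
    (LinearMap.mulLeft k (act (U u) 1) ∘ₗ act.flip r ∘ₗ LinearMap.mulLeft k (U u)))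
    (fun v => ?_) (fun l hl hl' => ?_) l
  · simpa using map_act u v r
  simp only [LinearMap.mem_eqLocus, LinearMap.comp_apply, LinearMap.flip_apply,
    LinearMap.mulLeft_apply] at *
  -- `e w e = e w` for `e = u · 1`, because `u · w` absorbs `e` on the right.
  have ewe : act (U u) 1 * act x 1 * act (U u) 1 = act (U u) 1 * act x 1 := by
    have := map_mul' u (act x 1) 1
    rw [mul_one, map_act_x, smul_mul_assoc] at this
    exact (smul_right_injective R (inv_ne_zero (char_ne_zero χ u)) this).symm
  rw [act_map_act_x_mul map_mul' map_act_x tw, hD.act_map_mul_x_mul tw, hl, hl', ← mul_assoc,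
    ewe, mul_smul_comm, mul_sub]
  simp only [mul_assoc]

include hD one_act map_mul' map_act map_act_symm map_act_x tw in
lemma act_map_act_symm_of_isTwisted (u : G) (l : H) (r : R) :
    act (U u) (act l r) = act (U u * l) r * act (U u) 1 := by
  refine hD.mem_of_step (LinearMap.eqLocus (act (U u) ∘ₗ act.flip r)
    (LinearMap.mulRight k (act (U u) 1) ∘ₗ act.flip r ∘ₗ LinearMap.mulLeft k (U u)))
    (fun v => ?_) (fun l hl hl' => ?_) l
  · simpa using map_act_symm u v r
  simp only [LinearMap.mem_eqLocus, LinearMap.comp_apply, LinearMap.flip_apply,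
    LinearMap.mulLeft_apply, LinearMap.mulRight_apply] at *
  -- In the symmetric case `e = u · 1` is central: both `e s` and `s e` equal `u · (u⁻¹ · s)`.
  have central : ∀ s, act (U u) 1 * s = s * act (U u) 1 := by
    intro s
    have := (map_act u u⁻¹ s).symm.trans (map_act_symm u u⁻¹ s)
    rwa [mul_inv_cancel, U.map_one, one_act] at this
  have idem : ∀ s, act (U u) 1 * act (U u) s = act (U u) s := by
    intro s
    rw [← map_mul', one_mul]
  rw [act_map_act_x_mul map_mul' map_act_x tw, hD.act_map_mul_x_mul tw, smul_mul_assoc,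
    sub_mul, mul_assoc _ _ (act (U u) 1), ← hl, mul_assoc _ (act x 1) (act (U u) 1), ← central,
    ← mul_assoc _ (act (U u) 1) (act x 1), ← hl', central (act x 1), mul_assoc, idem]

include hD one_act map_mul' map_act map_act_x tw in
/-- An action by twisted maps whose restriction to `G` is a partial action with
`u · w = χ(u)⁻¹ (u · 1) w` is a partial action: both sides of each axiom are twisted in the acting
element, and so only need to be compared on `G`. -/
lemma isPartialAction_of_isTwisted : IsPartialAction act where
  one_act := one_act
  act_mul h r s := by
    refine LinearMap.congr_fun (hD.isTwisted_ext (tw (r * s))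
      ((tw r).sweedler (hD.comul_apply γ) hD.comul_x (tw s)) fun u => ?_) h
    rw [sweedler_of_comul_eq_tmul _ _ (hD.comul_apply u)]
    exact map_mul' u r s
  act_act h l r := by
    refine LinearMap.congr_fun (hD.isTwisted_ext (tw (act l r))
      ((tw 1).sweedler (hD.comul_apply γ) hD.comul_x ((tw r).comp_mulRight l)) fun u => ?_) h
    rw [sweedler_of_comul_eq_tmul _ _ (hD.comul_apply u)]
    exact hD.act_map_act_of_isTwisted map_mul' map_act map_act_x tw u l r

include hD one_act map_mul' map_act map_act_symm map_act_x tw in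
lemma isSymmetricPartialAction_of_isTwisted : IsSymmetricPartialAction act where
  toIsPartialAction := hD.isPartialAction_of_isTwisted one_act map_mul' map_act map_act_x tw
  act_act_symm h l r := by
    refine LinearMap.congr_fun (hD.isTwisted_ext (tw (act l r))
      (((tw r).comp_mulRight l).sweedler (hD.comul_apply γ) hD.comul_x (tw 1)) fun u => ?_) h
    rw [sweedler_of_comul_eq_tmul _ _ (hD.comul_apply u)]
    exact hD.act_map_act_symm_of_isTwisted one_act map_mul' map_act map_act_symm map_act_x tw u l r

end Restriction

end IsSkewExtension

end SkewExtension

/-! ### Bases of Ore extensions -/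

section OreCoefficients

variable {k A H : Type*} [Field k] [Ring A] [Ring H] [Algebra k A] [Algebra k H]

/-- In an Ore extension, the `n`-th coefficient is a linear functional with values in `A`. -/
lemma IsOreExtension.exists_coeff {σ : A ≃ₐ[k] A} {ι : A →ₐ[k] H} {x : H}
    (h : IsOreExtension σ ι x) :
    ∃ c : ℕ → H →ₗ[k] A, ∀ n i a, c n (ι a * x ^ i) = if i = n then a else 0 := by
  classical
  let e : (ℕ →₀ A) →ₗ[k] H :=
    Finsupp.lsum k fun i => LinearMap.mulRight k (x ^ i) ∘ₗ ι.toLinearMap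
  have he : ∀ p, e p = p.sum fun i a => ι a * x ^ i := fun p => by rfl
  have hbij : Function.Bijective e := by
    rw [Function.bijective_iff_existsUnique]
    intro b
    obtain ⟨p, hp, hu⟩ := h.existsUnique_repr b
    exact ⟨p, (he p).trans hp.symm, fun p' hp' => hu p' ((he p').symm.trans hp').symm⟩
  refine ⟨fun n => Finsupp.lapply n ∘ₗ (LinearEquiv.ofBijective e hbij).symm.toLinearMap,
    fun n i a => ?_⟩
  have : (LinearEquiv.ofBijective e hbij).symm (ι a * x ^ i) = Finsupp.single i a := by
    rw [LinearEquiv.symm_apply_eq, LinearEquiv.ofBijective_apply, he]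
    simp
  simp [this, Finsupp.single_apply]

/-- An Ore extension is spanned by the products `xʲ a`, with the coefficients on the right. -/
lemma IsOreExtension.eq_top {σ : A ≃ₐ[k] A} {ι : A →ₐ[k] H} {x : H}
    (h : IsOreExtension σ ι x) (M : Submodule k H) (hM : ∀ j a, x ^ j * ι a ∈ M) : M = ⊤ := by
  have hswap : ∀ j a, ∃ b, ι a * x ^ j = x ^ j * ι b := by
    intro j
    induction j with
    | zero => exact fun a => ⟨a, by simp⟩
    | succ j ih =>
      intro a
      obtain ⟨b, hb⟩ := ih a
      refine ⟨σ.symm b, ?_⟩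
      rw [pow_succ, ← mul_assoc, hb, mul_assoc, mul_assoc, h.x_mul, σ.apply_symm_apply]
  refine eq_top_iff.2 fun l _ => ?_
  obtain ⟨p, rfl, -⟩ := h.existsUnique_repr l
  refine M.sum_mem fun j _ => ?_
  obtain ⟨b, hb⟩ := hswap j (p j)
  simp only [hb]
  exact hM j b

end OreCoefficients

/-! ### Hopf-Ore extensions of group algebras -/

section GroupAlgebra

variable {k G H : Type*} [Field k] [Group G] [Ring H] [HopfAlgebra k H]
  {σ : MonoidAlgebra k G ≃ₐ[k] MonoidAlgebra k G} {ι : MonoidAlgebra k G →ₐc[k] H} {x : H}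

lemma comul_of (u : G) : comul (R := k) (MonoidAlgebra.of k G u) =
    MonoidAlgebra.of k G u ⊗ₜ[k] MonoidAlgebra.of k G u :=
  (MonoidAlgebra.isGroupLikeElem_of (R := k) u).comul_eq_tmul_self

lemma counit_of (u : G) : counit (R := k) (MonoidAlgebra.of k G u) = 1 :=
  (MonoidAlgebra.isGroupLikeElem_of (R := k) u).counit_eq_one

/-- Comparing the coefficients of `x ⊗ 1` and of `1 ⊗ x` in `Δ(x) Δ(u) = Δ(σ(u)) Δ(x)` shows that
`σ` multiplies the grouplike elements by scalars and that `γ` is central in `G`. -/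
lemma IsHopfOreExtension.apply_of {γ : G}
    (hH : IsHopfOreExtension σ ι x (MonoidAlgebra.of k G γ)) (u : G) :
    σ (MonoidAlgebra.of k G u) =
      oreCharacter σ (MonoidAlgebra.of k G u) • MonoidAlgebra.of k G u ∧ γ * u = u * γ := by
  obtain ⟨c, hc⟩ := hH.isOreExtension.exists_coeff
  set a := MonoidAlgebra.of k G u with ha
  set b := MonoidAlgebra.of k G γ with hb
  have hc0 : ∀ n a, c n (ι a) = if 0 = n then a else 0 := fun n a => by simpa using hc n 0 a
  have hc1 : ∀ n a, c n (ι a * x) = if 1 = n then a else 0 := fun n a => by simpa using hc n 1 a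
  have main : comul (R := k) x * comul (ι a) = comul (ι (σ a)) * comul x := by
    rw [← Bialgebra.comul_mul, ← Bialgebra.comul_mul]
    exact congrArg _ (hH.isOreExtension.x_mul a)
  have hιcomul : ∀ a, comul (R := k) (ι a) =
      TensorProduct.map (ι : MonoidAlgebra k G →ₐ[k] H).toLinearMap
        (ι : MonoidAlgebra k G →ₐ[k] H).toLinearMap (comul a) := fun a =>
    (CoalgHomClass.map_comp_comul_apply ι a).symm
  rw [hιcomul, hιcomul, hH.comul_x, ha, comul_of, ← ha] at main
  have hxa : x * ι a = ι (σ a) * x := hH.isOreExtension.x_mul a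
  -- `c 1 ⊗ c 0` extracts the coefficient of `x ⊗ 1`, and `c 0 ⊗ c 1` that of `1 ⊗ x`.
  have h10 : ∀ t : MonoidAlgebra k G ⊗[k] MonoidAlgebra k G, TensorProduct.map (c 1) (c 0)
      (TensorProduct.map (ι : MonoidAlgebra k G →ₐ[k] H).toLinearMap
        (ι : MonoidAlgebra k G →ₐ[k] H).toLinearMap t * (x ⊗ₜ[k] (1 : H) + ι b ⊗ₜ[k] x)) = t := by
    intro t
    induction t using TensorProduct.induction_on with
    | zero => simp
    | tmul d e => simp [mul_add, hc0, hc1]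
    | add s t hs ht => simp only [map_add, add_mul, hs, ht]
  have h01 : ∀ t : MonoidAlgebra k G ⊗[k] MonoidAlgebra k G, TensorProduct.map (c 0) (c 1)
      (TensorProduct.map (ι : MonoidAlgebra k G →ₐ[k] H).toLinearMap
        (ι : MonoidAlgebra k G →ₐ[k] H).toLinearMap t * (x ⊗ₜ[k] (1 : H) + ι b ⊗ₜ[k] x)) =
      t * (b ⊗ₜ[k] 1) := by
    intro t
    induction t using TensorProduct.induction_on with
    | zero => simp
    | tmul d e => simp [mul_add, hc0, hc1, ← map_mul]
    | add s t hs ht => simp only [map_add, add_mul, hs, ht]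
  have hσ : σ a ⊗ₜ[k] a = comul (σ a) := by
    have := congrArg (TensorProduct.map (c 1) (c 0)) main
    rw [h10] at this
    simpa [add_mul, hxa, hc0, hc1, ← map_mul] using this
  -- Applying `ε ⊗ id` to `Δ(σ(u)) = σ(u) ⊗ u` gives `σ(u) = ε(σ(u)) u`.
  have hσ' : oreCharacter σ a • a = σ a := by
    have := congrArg (fun t => TensorProduct.lid k _ (LinearMap.rTensor _ counit t)) hσ
    simp only [rTensor_counit_comul] at this
    simpa [oreCharacter] using this
  refine ⟨hσ'.symm, MonoidAlgebra.of_injective (R := k) ?_⟩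
  have hba : oreCharacter σ a • (b * a) = oreCharacter σ a • (a * b) := by
    have := congrArg (TensorProduct.map (c 0) (c 1)) main
    rw [h01, ← hσ] at this
    have := congrArg (fun t => TensorProduct.rid k _ (LinearMap.lTensor _ counit t)) this
    have hεa : counit (R := k) a = 1 := counit_of u
    simpa [add_mul, hxa, hc0, hc1, ← map_mul, hεa, ← hσ'] using this
  rw [map_mul, map_mul]
  exact smul_right_injective _ (IsSkewExtension.char_ne_zero
    ((oreCharacter σ : MonoidAlgebra k G →* k).comp (MonoidAlgebra.of k G)) u) hba

lemma IsHopfOreExtension.isSkewExtension {γ : G}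
    (hH : IsHopfOreExtension σ ι x (MonoidAlgebra.of k G γ)) :
    IsSkewExtension ((ι : MonoidAlgebra k G →* H).comp (MonoidAlgebra.of k G))
      ((oreCharacter σ : MonoidAlgebra k G →* k).comp (MonoidAlgebra.of k G)) γ x where
  comul_apply u := ((MonoidAlgebra.isGroupLikeElem_of (R := k) u).map ι).comul_eq_tmul_self
  comul_x := hH.comul_x
  x_mul u := by
    have := hH.isOreExtension.x_mul (MonoidAlgebra.of k G u)
    rw [(hH.apply_of u).1, map_smul, smul_mul_assoc] at this
    exact this
  central u := (hH.apply_of u).2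
  eq_top M hM := hH.isOreExtension.eq_top M fun j a => by
    induction a using MonoidAlgebra.induction_on with
    | of u => exact hM j u
    | add a b ha hb => rw [map_add, mul_add]; exact M.add_mem ha hb
    | smul c a ha => rw [map_smul, mul_smul_comm]; exact M.smul_mem c ha

lemma IsHopfOreExtension.symm_apply_of {γ : G}
    (hH : IsHopfOreExtension σ ι x (MonoidAlgebra.of k G γ)) (u : G) :
    σ.symm (MonoidAlgebra.of k G u) =
      (oreCharacter σ (MonoidAlgebra.of k G u))⁻¹ • MonoidAlgebra.of k G u := by
  have hχ : oreCharacter σ (MonoidAlgebra.of k G u) ≠ 0 := IsSkewExtension.char_ne_zero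
    ((oreCharacter σ : MonoidAlgebra k G →* k).comp (MonoidAlgebra.of k G)) u
  rw [AlgEquiv.symm_apply_eq, map_smul, (hH.apply_of u).1, smul_smul, inv_mul_cancel₀ hχ, one_smul]

variable {R : Type*} [Ring R] [Algebra k R]

section Restriction

variable {act : MonoidAlgebra k G →ₗ[k] R →ₗ[k] R}

lemma IsPartialAction.act_of_mul (h : IsPartialAction act) (u : G) (r s : R) :
    act (MonoidAlgebra.of k G u) (r * s) =
      act (MonoidAlgebra.of k G u) r * act (MonoidAlgebra.of k G u) s := by
  rw [h.act_mul, sweedler_of_comul_eq_tmul _ _ (comul_of u)]; rfl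

lemma IsPartialAction.act_of_act_of (h : IsPartialAction act) (u v : G) (r : R) :
    act (MonoidAlgebra.of k G u) (act (MonoidAlgebra.of k G v) r) =
      act (MonoidAlgebra.of k G u) 1 * act (MonoidAlgebra.of k G (u * v)) r := by
  rw [h.act_act, sweedler_of_comul_eq_tmul _ _ (comul_of u), map_mul]; rfl

lemma IsSymmetricPartialAction.act_of_act_of_symm (h : IsSymmetricPartialAction act) (u v : G)
    (r : R) :
    act (MonoidAlgebra.of k G u) (act (MonoidAlgebra.of k G v) r) =
      act (MonoidAlgebra.of k G (u * v)) r * act (MonoidAlgebra.of k G u) 1 := by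
  rw [h.act_act_symm, sweedler_of_comul_eq_tmul _ _ (comul_of u), map_mul]; rfl

end Restriction

lemma sweedler_comp_bialgHom {A : Type*} [Ring A] [HopfAlgebra k A] (f : A →ₐc[k] H)
    (u v : H →ₗ[k] R) (a : A) :
    sweedler (u ∘ₗ (f : A →ₐ[k] H).toLinearMap) (v ∘ₗ (f : A →ₐ[k] H).toLinearMap) a =
      sweedler u v (f a) := by
  simp only [sweedler, LinearMap.comp_apply]
  rw [TensorProduct.map_comp, LinearMap.comp_apply]
  congr 2
  exact CoalgHomClass.map_comp_comul_apply f a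

lemma IsPartialAction.comp_bialgHom {A : Type*} [Ring A] [HopfAlgebra k A] (f : A →ₐc[k] H)
    {act : H →ₗ[k] R →ₗ[k] R} (h : IsPartialAction act) :
    IsPartialAction (act ∘ₗ (f : A →ₐ[k] H).toLinearMap) where
  one_act r := by simpa using h.one_act r
  act_mul a r s := (h.act_mul (f a) r s).trans (sweedler_comp_bialgHom f _ _ a).symm
  act_act a b r := by
    refine (h.act_act (f a) (f b) r).trans ((sweedler_comp_bialgHom f _ _ a).symm.trans ?_)
    congr 2
    ext c
    simp

lemma IsSymmetricPartialAction.comp_bialgHom {A : Type*} [Ring A] [HopfAlgebra k A]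
    (f : A →ₐc[k] H) {act : H →ₗ[k] R →ₗ[k] R} (h : IsSymmetricPartialAction act) :
    IsSymmetricPartialAction (act ∘ₗ (f : A →ₐ[k] H).toLinearMap) where
  toIsPartialAction := h.toIsPartialAction.comp_bialgHom f
  act_act_symm a b r := by
    refine (h.act_act_symm (f a) (f b) r).trans ((sweedler_comp_bialgHom f _ _ a).symm.trans ?_)
    congr 2
    ext c
    simp

lemma IsHopfOreExtension.conditions_of_isPartialAction {g : MonoidAlgebra k G}
    (hH : IsHopfOreExtension σ ι x g) {act : H →ₗ[k] R →ₗ[k] R} (hg : act (ι g) 1 = 0)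
    (h : IsPartialAction act) :
    (∀ a, act (ι a) (act x 1) = act (ι (σ.symm a)) 1 * act x 1) ∧
      IsGivenByExtensionFormula (ι : MonoidAlgebra k G →ₐ[k] H) x g act
        (oreCharacter σ g) (act x 1) := by
  obtain ⟨γ, rfl⟩ := MonoidAlgebra.isGroupLikeElem_iff_mem_range_of.1 hH.isGroupLikeElem
  have hD := hH.isSkewExtension
  refine ⟨fun a => ?_, fun j a r => ?_⟩
  · induction a using MonoidAlgebra.induction_on with
    | of u =>
      rw [hH.symm_apply_of, map_smul, map_smul, LinearMap.smul_apply, smul_mul_assoc]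
      exact hD.act_map_act_x h hg u
    | add a b ha hb => simp only [map_add, LinearMap.add_apply, add_mul, ha, hb]
    | smul c a ha => simp only [map_smul, LinearMap.smul_apply, smul_mul_assoc, ha]
  · have := (hD.isTwisted_of_isPartialAction h hg r).pow_mul (hD.map_mul_x γ) j (ι a)
    refine this.trans (Finset.sum_congr rfl fun i _ => ?_)
    rw [map_mul, map_pow]
    rfl

lemma IsHopfOreExtension.isTwisted_of_isGivenByExtensionFormula {γ : G}
    (hH : IsHopfOreExtension σ ι x (MonoidAlgebra.of k G γ)) {act : H →ₗ[k] R →ₗ[k] R}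
    (h : IsGivenByExtensionFormula (ι : MonoidAlgebra k G →ₐ[k] H) x (MonoidAlgebra.of k G γ) act
      (oreCharacter σ (MonoidAlgebra.of k G γ)) (act x 1)) (r : R) :
    IsTwisted x (ι (MonoidAlgebra.of k G γ)) (act x 1) (act.flip r) := by
  refine hH.isSkewExtension.isTwisted_of_pow_mul fun j u => ?_
  refine (h j (MonoidAlgebra.of k G u) r).trans (Finset.sum_congr rfl fun i _ => ?_)
  rw [map_mul, map_pow]
  rfl

end GroupAlgebra

/-- `act` is a linear map `kG[x, σ] ⊗ R → R`, where `H = kG[x, σ]` is a Hopf-Ore extension of the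
group algebra `kG`; `act.comp ι` is its restriction to `kG ⊗ R`. -/
theorem mainTheorem3 {k G H R : Type*} [Field k] [IsAlgClosed k] [CharZero k] [Group G]
    [Ring H] [HopfAlgebra k H] [Ring R] [Algebra k R]
    (σ : MonoidAlgebra k G ≃ₐ[k] MonoidAlgebra k G) (ι : MonoidAlgebra k G →ₐc[k] H)
    (x : H) (g : MonoidAlgebra k G) (hH : IsHopfOreExtension σ ι x g)
    (act : H →ₗ[k] R →ₗ[k] R) (hg : act (ι g) 1 = 0) :
    (IsPartialAction act ↔
      IsPartialAction (act ∘ₗ ((ι : MonoidAlgebra k G →ₐ[k] H).toLinearMap)) ∧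
      (∀ a : MonoidAlgebra k G, act (ι a) (act x 1) = act (ι (σ.symm a)) 1 * act x 1) ∧
      IsGivenByExtensionFormula (ι : MonoidAlgebra k G →ₐ[k] H) x g act
        (oreCharacter σ g) (act x 1)) ∧
    (IsSymmetricPartialAction act ↔
      IsSymmetricPartialAction (act ∘ₗ ((ι : MonoidAlgebra k G →ₐ[k] H).toLinearMap)) ∧
      (∀ a : MonoidAlgebra k G, act (ι a) (act x 1) = act (ι (σ.symm a)) 1 * act x 1) ∧
      IsGivenByExtensionFormula (ι : MonoidAlgebra k G →ₐ[k] H) x g act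
        (oreCharacter σ g) (act x 1)) := by
  obtain ⟨γ, rfl⟩ := MonoidAlgebra.isGroupLikeElem_iff_mem_range_of.1 hH.isGroupLikeElem
  have hD := hH.isSkewExtension
  have map_act_x (h2 : ∀ a : MonoidAlgebra k G,
      act (ι a) (act x 1) = act (ι (σ.symm a)) 1 * act x 1) (u : G) :
      act (ι (MonoidAlgebra.of k G u)) (act x 1) = (oreCharacter σ (MonoidAlgebra.of k G u))⁻¹ •
        (act (ι (MonoidAlgebra.of k G u)) 1 * act x 1) := by
    rw [h2, hH.symm_apply_of, map_smul, map_smul, LinearMap.smul_apply, smul_mul_assoc]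
  refine ⟨⟨fun h => ⟨h.comp_bialgHom ι, hH.conditions_of_isPartialAction hg h⟩, ?_⟩,
    ⟨fun h => ⟨h.comp_bialgHom ι, hH.conditions_of_isPartialAction hg h.toIsPartialAction⟩, ?_⟩⟩
  · rintro ⟨h1, h2, h3⟩
    exact hD.isPartialAction_of_isTwisted (by simpa using h1.one_act) h1.act_of_mul
      (fun u v r => by simpa using h1.act_of_act_of u v r) (map_act_x h2)
      (hH.isTwisted_of_isGivenByExtensionFormula h3)
  · rintro ⟨h1, h2, h3⟩
    exact hD.isSymmetricPartialAction_of_isTwisted (by simpa using h1.one_act)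
      h1.toIsPartialAction.act_of_mul
      (fun u v r => by simpa using h1.toIsPartialAction.act_of_act_of u v r)
      (fun u v r => by simpa using h1.act_of_act_of_symm u v r) (map_act_x h2)
      (hH.isTwisted_of_isGivenByExtensionFormula h3)
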